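/- Let $\mathbb K$ be an algebraically closed field of characteristic zero, let $n\ge 0$, and let $R=\mathbb K[X_0,\dots,X_n]$ act on $S=\mathbb K[x_0,\dots,x_n]$ by partial differentiation, $\Phi\circ f=\Phi\left(\frac{\partial}{\partial x_0},\dots,\frac{\partial}{\partial x_n}\right)f$. For a form $f\in S$ write $\mathrm{Ann}_R(f)=\{\Phi\in R:\Phi\circ f=0\}$. Let $\mathcal A$ be a finite set of (pairwise distinct) hyperplanes in $\mathbb P^n_{\mathbb K}$, and let $f=\prod_{H\in\mathcal A}\alpha_H$, where $\alpha_H\in S$ is a linear form with zero set $H$. Suppose that $\mathcal A$ is generic, that is, for every $k$ the intersection of any $k$ distinct hyperplanes of $\mathcal A$ has codimension $\min\{k,n+1\}$ (codimension $n+1$ meaning that the intersection in $\mathbb P^n$ is empty). Suppose further that $|\mathcal A|\ge n+2$ and that the ideal $\mathrm{Ann}_R(f)$ is a complete intersection, that is, it is generated by a regular sequence of homogeneous polynomials in $R$. Then $|\mathcal A|\ge n(n+1)$. -/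

import Mathlib

open MvPolynomial

/-- The operator `∂/∂xᵢ` on `K[x₀, …, xₙ]`. -/
noncomputable def partialDiff (K : Type*) [Field K] (n : ℕ) (i : Fin (n + 1)) :
    Module.End K (MvPolynomial (Fin (n + 1)) K) :=
  (pderiv i : Derivation K (MvPolynomial (Fin (n + 1)) K) _).toLinearMap

theorem partialDiff_commute (K : Type*) [Field K] (n : ℕ) (i j : Fin (n + 1)) :
    Commute (partialDiff K n i) (partialDiff K n j) := by
  have h : ⁅(pderiv i : Derivation K (MvPolynomial (Fin (n + 1)) K) (MvPolynomial (Fin (n + 1)) K)),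
      (pderiv j : Derivation K (MvPolynomial (Fin (n + 1)) K) _)⁆ = 0 := by
    apply MvPolynomial.derivation_ext
    intro k
    simp only [Derivation.commutator_apply, pderiv_X, Derivation.coe_zero, Pi.zero_apply]
    by_cases h1 : j = k <;> by_cases h2 : i = k <;> simp [h1, h2]
  refine LinearMap.ext fun f => ?_
  have h3 := DFunLike.congr_fun h f
  rw [Derivation.commutator_apply, Derivation.coe_zero, Pi.zero_apply, sub_eq_zero] at h3
  exact h3

theorem partialDiff_pow_pairwise (K : Type*) [Field K] (n : ℕ) (m : Fin (n + 1) → ℕ)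
    (s : Set (Fin (n + 1))) :
    s.Pairwise (Function.onFun Commute fun i => partialDiff K n i ^ m i) :=
  fun i _ j _ _ => (partialDiff_commute K n i j).pow_pow (m i) (m j)

/-- The higher order partial derivative `∂^|m| / ∂x₀^(m 0) ⋯ ∂xₙ^(m n)`, as a monoid homomorphism
from exponent vectors (under addition) to operators (under composition). -/
noncomputable def monomialDiff (K : Type*) [Field K] (n : ℕ) :
    Multiplicative (Fin (n + 1) →₀ ℕ) →* Module.End K (MvPolynomial (Fin (n + 1)) K) where
  toFun m := Finset.univ.noncommProd (fun i => partialDiff K n i ^ m.toAdd i)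
    (partialDiff_pow_pairwise K n m.toAdd _)
  map_one' := by
    refine (Finset.noncommProd_eq_pow_card _ _ _ 1 fun i _ => ?_).trans (one_pow _)
    simp
  map_mul' a b := by
    refine Eq.trans ?_ (Finset.noncommProd_mul_distrib
      (fun i => partialDiff K n i ^ a.toAdd i) (fun i => partialDiff K n i ^ b.toAdd i) _ _
      (fun i _ j _ _ => (partialDiff_commute K n i j).pow_pow _ _))
    refine Finset.noncommProd_congr rfl (fun i _ => ?_) _
    simp [pow_add]

/-- The apolar action of `R = K[X₀, …, Xₙ]` on `S = K[x₀, …, xₙ]`: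
`Φ ∘ f = Φ(∂/∂x₀, …, ∂/∂xₙ) f`, written here `apolarAction K n Φ f`. -/
noncomputable def apolarAction (K : Type*) [Field K] (n : ℕ) :
    MvPolynomial (Fin (n + 1)) K →ₐ[K] Module.End K (MvPolynomial (Fin (n + 1)) K) :=
  AddMonoidAlgebra.lift K _ (Fin (n + 1) →₀ ℕ) (monomialDiff K n)

/-- A monomial `c X^m` acts as `c ∂^m`. -/
theorem apolarAction_monomial (K : Type*) [Field K] (n : ℕ) (m : Fin (n + 1) →₀ ℕ) (c : K) :
    apolarAction K n (monomial m c) = c • monomialDiff K n (Multiplicative.ofAdd m) :=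
  AddMonoidAlgebra.lift_single _ _ _

/-- The variable `Xᵢ` acts as `∂/∂xᵢ`. -/
theorem apolarAction_X (K : Type*) [Field K] (n : ℕ) (i : Fin (n + 1))
    (f : MvPolynomial (Fin (n + 1)) K) : apolarAction K n (X i) f = pderiv i f := by
  have h : monomialDiff K n (Multiplicative.ofAdd (Finsupp.single i 1)) = partialDiff K n i := by
    have hp := partialDiff_pow_pairwise K n ⇑(Finsupp.single i 1)
    refine (Finset.noncommProd_congr (Finset.insert_erase (Finset.mem_univ i)).symm
      (fun j _ => rfl) (hp _)).trans ?_
    refine (Finset.noncommProd_insert_of_notMem _ _ _ (hp _) (Finset.notMem_erase i _)).trans ?_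
    rw [Finset.noncommProd_eq_pow_card _ _ _ 1 fun j hj => by
        simp [Finsupp.single_eq_of_ne (Finset.ne_of_mem_erase hj)]]
    simp
  rw [X, apolarAction_monomial, h, one_smul]
  rfl

/-- The apolar ideal `Ann_R(f) = {Φ ∈ R : Φ ∘ f = 0}`. -/
noncomputable def apolarIdeal {K : Type*} [Field K] {n : ℕ} (f : MvPolynomial (Fin (n + 1)) K) :
    Ideal (MvPolynomial (Fin (n + 1)) K) where
  carrier := {Φ | apolarAction K n Φ f = 0}
  zero_mem' := by simp
  add_mem' {a b} ha hb := by
    simp only [Set.mem_ofPred_eq] at ha hb ⊢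
    rw [map_add, LinearMap.add_apply, ha, hb, add_zero]
  smul_mem' c a ha := by
    simp only [Set.mem_ofPred_eq] at ha ⊢
    rw [smul_eq_mul, map_mul, Module.End.mul_apply, ha, map_zero]

/-- A (simple) arrangement of hyperplanes in the projective space `ℙⁿ` over `K`: a finite set of
hyperplanes, each given by the linear subspace of codimension one of `K^(n+1)` that it is the
projectivization of. -/
structure HyperplaneArrangement (K : Type*) [Field K] (n : ℕ) where
  hyperplanes : Finset (Submodule K (Fin (n + 1) → K))
  codim_eq_one : ∀ H ∈ hyperplanes, Module.finrank K ((Fin (n + 1) → K) ⧸ H) = 1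

namespace HyperplaneArrangement

variable {K : Type*} [Field K] {n : ℕ}

/-- The arrangement is generic: the intersection of any `k` of its hyperplanes has codimension
`min k (n + 1)`. Codimension `n + 1` means that the linear subspaces meet only in the origin, so
that the projective hyperplanes have empty intersection. -/
def IsGeneric (A : HyperplaneArrangement K n) : Prop :=
  ∀ B ⊆ A.hyperplanes,
    Module.finrank K ((Fin (n + 1) → K) ⧸ (⨅ H ∈ B, H)) = min B.card (n + 1)

/-- `f` is a defining polynomial of the arrangement: a product, over its hyperplanes `H`, of
linear forms `α H` with zero set `H`. It is unique up to a nonzero scalar. -/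
def IsDefiningPolynomial (A : HyperplaneArrangement K n) (f : MvPolynomial (Fin (n + 1)) K) :
    Prop :=
  ∃ α : Submodule K (Fin (n + 1) → K) → MvPolynomial (Fin (n + 1)) K,
    (∀ H ∈ A.hyperplanes, (α H).IsHomogeneous 1 ∧ ∀ x, eval x (α H) = 0 ↔ x ∈ H) ∧
    f = ∏ H ∈ A.hyperplanes, α H

end HyperplaneArrangement

/-- A homogeneous ideal of `K[X₀, …, Xₙ]` is a complete intersection: it is generated by a regular
sequence of homogeneous polynomials (of arbitrary length and degrees). -/
def IsGradedCompleteIntersection {K : Type*} [Field K] {n : ℕ}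
    (I : Ideal (MvPolynomial (Fin (n + 1)) K)) : Prop :=
  ∃ rs : List (MvPolynomial (Fin (n + 1)) K),
    (∀ r ∈ rs, ∃ d, r.IsHomogeneous d) ∧
    RingTheory.Sequence.IsRegular (MvPolynomial (Fin (n + 1)) K) rs ∧
    I = Ideal.ofList rs

/-! Let `d` be the number of hyperplanes and `m = min n (d - n)`. Two estimates on the generators of
the apolar ideal collide. From below: no nonzero form `Φ` of degree `k ≤ m` kills `f`. For `k`
hyperplanes `T`, genericity gives a point `p` on those and no others; at `p`, `Φ ∘ f` equals `Φ ∘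
∏_T α` times the nonzero value of the remaining factors. So `Φ` kills every such `k`-fold product.
These span the forms of degree `k`, and the apolarity pairing is perfect in characteristic zero, so
`Φ = 0` (`IsGeneric.eq_zero_of_mem_apolarIdeal`). From above: the apolar ideal contains every form
of degree greater than `d`, so the quotient has a polynomial Hilbert series of degree at most `d`.
For a regular sequence of degrees `eᵢ` that series is `∏ (1 - X^eᵢ) / (1 - X)^(n+1)`. The order of
vanishing at `1` gives at least `n + 1` generators, and the degree gives `∑ eᵢ ≤ d + n + 1`
(`length_and_sum_totalDegree_le`). Hence `(n + 1)(m + 1) ≤ d + n + 1`, that is `(n + 1) m ≤ d`,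
which forces `m = n`. -/

namespace MvPolynomial

/-! ### Hilbert series of homogeneous complete intersections. -/

variable {σ K : Type*} [Field K]

theorem IsHomogeneous.homogeneousComponent_add_mul {r : MvPolynomial σ K} {e : ℕ}
    (hr : r.IsHomogeneous e) (j : ℕ) (b : MvPolynomial σ K) :
    homogeneousComponent (e + j) (r * b) = r * homogeneousComponent j b := by
  induction b using MvPolynomial.induction_on' with
  | add p q hp hq => rw [mul_add, map_add, hp, hq, map_add, mul_add]
  | monomial u a =>
    have hu : (monomial u a).IsHomogeneous u.degree := isHomogeneous_monomial a rfl
    rw [homogeneousComponent_of_mem ((mem_homogeneousSubmodule _ _).2 (hr.mul hu)),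
      homogeneousComponent_of_mem ((mem_homogeneousSubmodule _ _).2 hu)]
    by_cases h : u.degree = j <;> simp [h]

theorem IsHomogeneous.homogeneousComponent_mul_eq_zero {r : MvPolynomial σ K} {e : ℕ}
    (hr : r.IsHomogeneous e) {j : ℕ} (hj : j < e) (b : MvPolynomial σ K) :
    homogeneousComponent j (r * b) = 0 := by
  induction b using MvPolynomial.induction_on' with
  | add p q hp hq => rw [mul_add, map_add, hp, hq, add_zero]
  | monomial u a =>
    have hu : (monomial u a).IsHomogeneous u.degree := isHomogeneous_monomial a rfl
    rw [homogeneousComponent_of_mem ((mem_homogeneousSubmodule _ _).2 (hr.mul hu)), if_neg (by omega)]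

theorem homogeneousComponent_mem_ofList {rs : List (MvPolynomial σ K)}
    (hrs : ∀ r ∈ rs, ∃ d, r.IsHomogeneous d) {p : MvPolynomial σ K} (hp : p ∈ Ideal.ofList rs)
    (j : ℕ) : homogeneousComponent j p ∈ Ideal.ofList rs := by
  let : GradedAlgebra (homogeneousSubmodule σ K) := MvPolynomial.gradedAlgebra
  refine homogeneousComponent_mem_of_mem (Ideal.homogeneous_span _ _ fun r hr => ?_) hp j
  obtain ⟨d, hd⟩ := hrs r hr
  exact ⟨d, hd⟩

/-- The degree `j` part of an ideal of a polynomial ring. -/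
noncomputable def idealPart (I : Ideal (MvPolynomial σ K)) (j : ℕ) : Submodule K (MvPolynomial σ K) :=
  I.restrictScalars K ⊓ homogeneousSubmodule σ K j

theorem mem_idealPart {I : Ideal (MvPolynomial σ K)} {j : ℕ} {p : MvPolynomial σ K} :
    p ∈ idealPart I j ↔ p ∈ I ∧ p.IsHomogeneous j := Iff.rfl

instance [Finite σ] (j : ℕ) : FiniteDimensional K (homogeneousSubmodule σ K j) :=
  Module.Finite.iff_fg.2 (homogeneousSubmodule_fg σ K j)

instance [Finite σ] (I : Ideal (MvPolynomial σ K)) (j : ℕ) : FiniteDimensional K (idealPart I j) :=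
  Submodule.finiteDimensional_of_le inf_le_right

theorem idealPart_sup_span_of_lt {I : Ideal (MvPolynomial σ K)}
    (hI : ∀ p ∈ I, ∀ j, homogeneousComponent j p ∈ I) {r : MvPolynomial σ K} {e : ℕ}
    (hr : r.IsHomogeneous e) {j : ℕ} (hj : j < e) :
    idealPart (I ⊔ Ideal.span {r}) j = idealPart I j := by
  ext p
  simp only [mem_idealPart]
  refine ⟨fun ⟨hp, hpj⟩ => ⟨?_, hpj⟩, fun ⟨hp, hpj⟩ => ⟨Ideal.mem_sup_left hp, hpj⟩⟩
  obtain ⟨a, ha, c, hc, rfl⟩ := Submodule.mem_sup.1 hp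
  obtain ⟨b, rfl⟩ := Ideal.mem_span_singleton.1 hc
  rw [← homogeneousComponent_eq_self ((mem_homogeneousSubmodule _ _).2 hpj), map_add,
    hr.homogeneousComponent_mul_eq_zero hj, add_zero]
  exact hI a ha j

theorem idealPart_sup_span_add {I : Ideal (MvPolynomial σ K)}
    (hI : ∀ p ∈ I, ∀ j, homogeneousComponent j p ∈ I) {r : MvPolynomial σ K} {e : ℕ}
    (hr : r.IsHomogeneous e) (j : ℕ) :
    idealPart (I ⊔ Ideal.span {r}) (e + j) =
      idealPart I (e + j) ⊔ (homogeneousSubmodule σ K j).map (LinearMap.mulLeft K r) := by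
  ext p
  rw [mem_idealPart]
  constructor
  · rintro ⟨hp, hpj⟩
    obtain ⟨a, ha, c, hc, rfl⟩ := Submodule.mem_sup.1 hp
    obtain ⟨b, rfl⟩ := Ideal.mem_span_singleton.1 hc
    refine Submodule.mem_sup.2 ⟨homogeneousComponent (e + j) a, ⟨hI a ha _, homogeneousComponent_isHomogeneous _ _⟩,
      r * homogeneousComponent j b, ⟨_, homogeneousComponent_isHomogeneous _ _, rfl⟩, ?_⟩
    rw [← hr.homogeneousComponent_add_mul, ← map_add]
    exact homogeneousComponent_eq_self ((mem_homogeneousSubmodule _ _).2 hpj)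
  · intro hp
    obtain ⟨a, ⟨ha, haj⟩, _, ⟨b, hb, rfl⟩, rfl⟩ := Submodule.mem_sup.1 hp
    exact ⟨add_mem (Ideal.mem_sup_left ha) (Ideal.mem_sup_right
      (Ideal.mem_span_singleton.2 ⟨b, rfl⟩)), IsHomogeneous.add haj (hr.mul hb)⟩

theorem idealPart_inf_map_mulLeft {I : Ideal (MvPolynomial σ K)} {r : MvPolynomial σ K} {e : ℕ}
    (hr : r.IsHomogeneous e) (hreg : ∀ b, r * b ∈ I → b ∈ I) (j : ℕ) :
    idealPart I (e + j) ⊓ (homogeneousSubmodule σ K j).map (LinearMap.mulLeft K r) =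
      (idealPart I j).map (LinearMap.mulLeft K r) := by
  ext p
  constructor
  · rintro ⟨⟨hp, -⟩, b, hb, rfl⟩
    exact ⟨b, ⟨hreg b hp, hb⟩, rfl⟩
  · rintro ⟨b, ⟨hb, hbj⟩, rfl⟩
    exact ⟨⟨I.mul_mem_left r hb, hr.mul hbj⟩, b, hbj, rfl⟩

/-- The Hilbert series of the quotient by an ideal, whose coefficients are the dimensions of the
homogeneous parts. -/
noncomputable def hilbertSeries (I : Ideal (MvPolynomial σ K)) : PowerSeries ℤ :=
  PowerSeries.mk fun j => (Module.finrank K (homogeneousSubmodule σ K j) : ℤ) -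
    Module.finrank K (idealPart I j)

/-- Multiplication by `r` is injective on the quotient by `I` and shifts degrees by `e`; its
cokernel is the quotient by `I ⊔ (r)`. In coefficients this is the dimension formula for a sum and
an intersection of subspaces. -/
theorem hilbertSeries_sup_span [Finite σ] {I : Ideal (MvPolynomial σ K)}
    (hI : ∀ p ∈ I, ∀ j, homogeneousComponent j p ∈ I) {r : MvPolynomial σ K} {e : ℕ}
    (hr : r.IsHomogeneous e) (hr0 : r ≠ 0) (hreg : ∀ b, r * b ∈ I → b ∈ I) :
    hilbertSeries (I ⊔ Ideal.span {r}) = (1 - PowerSeries.X ^ e) * hilbertSeries I := by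
  ext j
  rw [sub_mul, one_mul, map_sub, PowerSeries.coeff_X_pow_mul']
  simp only [hilbertSeries, PowerSeries.coeff_mk]
  split_ifs with hj
  · obtain ⟨j, rfl⟩ := Nat.exists_eq_add_of_le hj
    have hinj : Function.Injective (LinearMap.mulLeft K r) := fun a b h => mul_left_cancel₀ hr0 h
    have h := Submodule.finrank_sup_add_finrank_inf_eq (idealPart I (e + j))
      ((homogeneousSubmodule σ K j).map (LinearMap.mulLeft K r))
    rw [← idealPart_sup_span_add hI hr, idealPart_inf_map_mulLeft hr hreg,
      (Submodule.equivMapOfInjective _ hinj _).finrank_eq.symm,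
      (Submodule.equivMapOfInjective _ hinj _).finrank_eq.symm] at h
    rw [Nat.add_sub_cancel_left]
    omega
  · rw [idealPart_sup_span_of_lt hI hr (by omega), sub_zero]

theorem finrank_homogeneousSubmodule [Fintype σ] (j : ℕ) :
    Module.finrank K (homogeneousSubmodule σ K j) = (Fintype.card σ + j - 1).choose j := by
  classical
  have h : {d : σ →₀ ℕ | d.degree = j} = (Finset.univ.finsuppAntidiag j : Finset (σ →₀ ℕ)) := by
    ext d
    simp [Finset.mem_finsuppAntidiag, Finsupp.degree_eq_sum]
  rw [homogeneousSubmodule_eq_finsupp_supported, h,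
    (AddMonoidAlgebra.supportedEquivFinsupp _).finrank_eq, Module.finrank_finsupp_self]
  simp only [Finset.coe_sort_coe]
  rw [Fintype.card_coe, Finset.card_finsuppAntidiag_nat_eq_choose, Finset.card_univ]

theorem finrank_idealPart_bot (j : ℕ) :
    Module.finrank K (idealPart (⊥ : Ideal (MvPolynomial σ K)) j) = 0 := by
  have h : idealPart (⊥ : Ideal (MvPolynomial σ K)) j = ⊥ := by
    ext p
    simp +contextual [mem_idealPart, isHomogeneous_zero]
  rw [h, finrank_bot]

theorem hilbertSeries_bot_mul (n : ℕ) :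
    hilbertSeries (⊥ : Ideal (MvPolynomial (Fin (n + 1)) K)) * (1 - PowerSeries.X) ^ (n + 1) =
      1 := by
  refine Eq.trans ?_ (PowerSeries.mk_add_choose_mul_one_sub_pow_eq_one ℤ n)
  congr 1
  ext j
  simp only [hilbertSeries, PowerSeries.coeff_mk, finrank_idealPart_bot,
    finrank_homogeneousSubmodule, Fintype.card_fin]
  rw [show n + 1 + j - 1 = n + j by omega, Nat.choose_symm_add]
  simp

theorem hilbertSeries_ofList_mul {n : ℕ} {rs : List (MvPolynomial (Fin (n + 1)) K)}
    (hrs : ∀ r ∈ rs, ∃ d, r.IsHomogeneous d) (hrs0 : ∀ r ∈ rs, r ≠ 0)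
    (hreg : RingTheory.Sequence.IsWeaklyRegular (MvPolynomial (Fin (n + 1)) K) rs) :
    hilbertSeries (Ideal.ofList rs) * (1 - PowerSeries.X) ^ (n + 1) =
      (rs.map fun r => 1 - PowerSeries.X ^ r.totalDegree).prod := by
  suffices ∀ i ≤ rs.length, hilbertSeries (Ideal.ofList (rs.take i)) *
      (1 - PowerSeries.X) ^ (n + 1) =
        ((rs.take i).map fun r => 1 - PowerSeries.X ^ r.totalDegree).prod by
    simpa using this rs.length le_rfl
  intro i
  induction i with
  | zero => intro _; simpa using hilbertSeries_bot_mul n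
  | succ i ih =>
    intro hi
    have hmem : rs[i] ∈ rs := List.getElem_mem _
    obtain ⟨d, hd⟩ := hrs _ hmem
    have hd' : rs[i].IsHomogeneous rs[i].totalDegree := by rwa [hd.totalDegree (hrs0 _ hmem)]
    have hr : ∀ b, rs[i] * b ∈ Ideal.ofList (rs.take i) → b ∈ Ideal.ofList (rs.take i) := by
      intro b hb
      have h := (isSMulRegular_quotient_iff_mem_of_smul_mem _ _).1 (hreg.regular_mod_prev i hi) b
      simpa [hb] using h
    rw [← List.take_append_getElem hi, Ideal.ofList_append, Ideal.ofList_singleton,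
      hilbertSeries_sup_span (fun p hp j => homogeneousComponent_mem_ofList
        (fun r h => hrs r (List.mem_of_mem_take h)) hp j) hd' (hrs0 _ hmem) hr, mul_assoc,
      ih (by omega), List.map_append, List.prod_append, mul_comm]
    simp

theorem natDegree_one_sub_X_pow (e : ℕ) : (1 - Polynomial.X ^ e : Polynomial ℤ).natDegree = e := by
  rw [← Polynomial.natDegree_neg, neg_sub, ← Polynomial.C_1, Polynomial.natDegree_X_pow_sub_C]

theorem one_sub_X_pow_ne_zero {e : ℕ} (he : 0 < e) : (1 - Polynomial.X ^ e : Polynomial ℤ) ≠ 0 := by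
  intro h
  have := natDegree_one_sub_X_pow e
  rw [h, Polynomial.natDegree_zero] at this
  omega

theorem natDegree_prod_one_sub_X_pow (l : List ℕ) (hl : ∀ e ∈ l, 0 < e) :
    (l.map fun e => (1 - Polynomial.X ^ e : Polynomial ℤ)).prod.natDegree = l.sum := by
  induction l with
  | nil => simp
  | cons e l ih =>
    have hl' := fun e he => hl e (List.mem_cons_of_mem _ he)
    rw [List.map_cons, List.prod_cons, Polynomial.natDegree_mul, ih hl', natDegree_one_sub_X_pow,
      List.sum_cons]
    · exact one_sub_X_pow_ne_zero (hl e List.mem_cons_self)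
    · refine List.prod_ne_zero fun h => ?_
      obtain ⟨e, he, he0⟩ := List.mem_map.1 h
      exact one_sub_X_pow_ne_zero (hl' e he) he0

/-- A homogeneous regular sequence generating an ideal that contains all forms of degree more
than `d` has at least as many elements as there are variables, and the sum of their degrees is
at most `d` plus the number of variables. -/
theorem length_and_sum_totalDegree_le {n d : ℕ} {rs : List (MvPolynomial (Fin (n + 1)) K)}
    (hrs : ∀ r ∈ rs, ∃ d, r.IsHomogeneous d) (hpos : ∀ r ∈ rs, 0 < r.totalDegree)
    (hreg : RingTheory.Sequence.IsWeaklyRegular (MvPolynomial (Fin (n + 1)) K) rs)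
    (htop : ∀ j, d < j → ∀ p : MvPolynomial (Fin (n + 1)) K, p.IsHomogeneous j →
      p ∈ Ideal.ofList rs) :
    n + 1 ≤ rs.length ∧ (rs.map totalDegree).sum ≤ d + (n + 1) := by
  have h := hilbertSeries_ofList_mul hrs (fun r hr h0 => by simpa [h0] using hpos r hr) hreg
  -- Truncation loses nothing: by `htop` the quotient vanishes in degrees above `d`.
  set P : Polynomial ℤ := PowerSeries.trunc (d + 1) (hilbertSeries (Ideal.ofList rs)) with hP
  have hPc : (P : PowerSeries ℤ) = hilbertSeries (Ideal.ofList rs) := by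
    ext j
    rw [Polynomial.coeff_coe, hP, PowerSeries.coeff_trunc]
    split_ifs with hj
    · rfl
    · have : idealPart (Ideal.ofList rs) j = homogeneousSubmodule (Fin (n + 1)) K j :=
        inf_eq_right.2 fun p hp => htop j (by omega) p hp
      simp only [hilbertSeries, PowerSeries.coeff_mk]
      rw [this, sub_self]
  have hpoly : P * (1 - Polynomial.X) ^ (n + 1) =
      (rs.map fun r => 1 - Polynomial.X ^ r.totalDegree).prod := by
    apply Polynomial.coe_injective ℤ
    rw [← Polynomial.coeToPowerSeries.ringHom_apply, ← Polynomial.coeToPowerSeries.ringHom_apply]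
    rw [map_mul, map_list_prod, List.map_map]
    simp only [map_pow, map_sub, map_one, Polynomial.coeToPowerSeries.ringHom_apply,
      Polynomial.coe_X, hPc, h]
    congr 2
    funext r
    simp
  have hPd : P.natDegree ≤ d := Nat.lt_succ_iff.1 (PowerSeries.natDegree_trunc_lt _ _)
  clear_value P
  clear h hPc htop hreg hrs hP
  constructor
  -- Each `1 - X^e` with `e > 0` is `1 - X` times a geometric sum whose value at `1` is `e ≠ 0`.
  · obtain ⟨G, hG1, hG⟩ : ∃ G : Polynomial ℤ, G.eval 1 ≠ 0 ∧
        (rs.map fun r => 1 - Polynomial.X ^ r.totalDegree).prod =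
          (1 - Polynomial.X) ^ rs.length * G := by
      clear hpoly
      induction rs with
      | nil => exact ⟨1, by simp, by simp⟩
      | cons r rs ih =>
        obtain ⟨G, hG1, hG⟩ := ih (fun r hr => hpos r (List.mem_cons_of_mem _ hr))
        refine ⟨(∑ i ∈ Finset.range r.totalDegree, Polynomial.X ^ i) * G, ?_, ?_⟩
        · have := hpos r List.mem_cons_self
          simp [Polynomial.eval_finsetSum, hG1]
          omega
        · rw [List.map_cons, List.prod_cons, hG, ← mul_neg_geom_sum, List.length_cons]
          ring
    -- With too few generators, cancelling powers of `1 - X` would leave such a factor in `G`,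
    -- against `G(1) ≠ 0`.
    by_contra! hlt
    obtain ⟨k, hk⟩ := Nat.exists_eq_add_of_lt hlt
    rw [hG, congrArg ((1 - Polynomial.X : Polynomial ℤ) ^ ·) hk, add_assoc, pow_add,
      mul_left_comm] at hpoly
    have h0 : (1 - Polynomial.X : Polynomial ℤ) ^ rs.length ≠ 0 := by
      simpa using pow_ne_zero rs.length (one_sub_X_pow_ne_zero one_pos)
    rw [← mul_left_cancel₀ h0 hpoly] at hG1
    simp at hG1
  · have hdeg := natDegree_prod_one_sub_X_pow (rs.map totalDegree) (by simpa using hpos)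
    rw [List.map_map] at hdeg
    change (List.map (fun r : MvPolynomial (Fin (n + 1)) K =>
      (1 - Polynomial.X ^ r.totalDegree : Polynomial ℤ)) rs).prod.natDegree = _ at hdeg
    rw [← hdeg, ← hpoly]
    refine Polynomial.natDegree_mul_le.trans (add_le_add ?_ ?_)
    · exact hPd
    · refine Polynomial.natDegree_pow_le.trans ?_
      refine (Nat.mul_le_mul_left _ (Polynomial.natDegree_sub_le _ _)).trans ?_
      simp

end MvPolynomial

/-! ### The apolarity pairing and derivatives of products of linear forms. -/

theorem Finsupp.exists_eq_add_single_of_degree_eq_succ {σ : Type*} {m : σ →₀ ℕ} {k : ℕ}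
    (hm : m.degree = k + 1) : ∃ (i : σ) (m' : σ →₀ ℕ), m = m' + single i 1 ∧ m'.degree = k := by
  have h0 : m ≠ 0 := by rintro rfl; simp at hm
  obtain ⟨i, hi⟩ := Finsupp.ne_iff.1 h0
  have h1 : single i 1 ≤ m := by
    rw [Finsupp.single_le_iff]
    exact Nat.one_le_iff_ne_zero.2 hi
  refine ⟨i, m - single i 1, (tsub_add_cancel_of_le h1).symm, ?_⟩
  have h2 := congrArg Finsupp.degree (tsub_add_cancel_of_le h1)
  rw [map_add, hm, Finsupp.degree_single] at h2
  omega

theorem Derivation.map_finsetProd {R A ι : Type*} [CommSemiring R] [CommRing A] [Algebra R A]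
    [DecidableEq ι] (D : Derivation R A A) (s : Finset ι) (f : ι → A) :
    D (∏ i ∈ s, f i) = ∑ i ∈ s, D (f i) * ∏ j ∈ s.erase i, f j := by
  induction s using Finset.induction_on with
  | empty => simp
  | insert a s ha ih =>
    rw [Finset.prod_insert ha, D.leibniz, ih, Finset.sum_insert ha, Finset.erase_insert ha,
      smul_eq_mul, smul_eq_mul, Finset.mul_sum, add_comm, mul_comm]
    refine congrArg _ (Finset.sum_congr rfl fun i hi => ?_)
    have hai : a ≠ i := fun h => ha (h ▸ hi)
    rw [Finset.erase_insert_of_ne hai, Finset.prod_insert fun h => ha (Finset.mem_of_mem_erase h)]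
    ring

section apolarity

variable {K : Type*} [Field K] {n : ℕ}

theorem apolarAction_monomial_add_single (m : Fin (n + 1) →₀ ℕ) (i : Fin (n + 1))
    (g : MvPolynomial (Fin (n + 1)) K) :
    apolarAction K n (monomial (m + Finsupp.single i 1) 1) g =
      apolarAction K n (monomial m 1) (pderiv i g) := by
  rw [← apolarAction_X, ← Module.End.mul_apply, ← map_mul, X, monomial_mul, one_mul]

theorem apolarAction_monomial_zero (g : MvPolynomial (Fin (n + 1)) K) :
    apolarAction K n (monomial 0 1) g = g := by
  change apolarAction K n 1 g = g
  rw [map_one, Module.End.one_apply]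

theorem apolarAction_eq_sum (Φ g : MvPolynomial (Fin (n + 1)) K) :
    apolarAction K n Φ g = ∑ m ∈ Φ.support, coeff m Φ • apolarAction K n (monomial m 1) g := by
  conv_lhs => rw [Φ.as_sum, map_sum, LinearMap.sum_apply]
  refine Finset.sum_congr rfl fun m _ => ?_
  rw [← LinearMap.smul_apply, ← map_smul, smul_monomial, smul_eq_mul, mul_one]

theorem apolarAction_monomial_eq_zero {k d : ℕ} (h : d < k) {m : Fin (n + 1) →₀ ℕ}
    (hm : m.degree = k) {f : MvPolynomial (Fin (n + 1)) K} (hf : f.IsHomogeneous d) :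
    apolarAction K n (monomial m 1) f = 0 := by
  induction k generalizing m d f with
  | zero => omega
  | succ k ih =>
    obtain ⟨i, m, rfl, hm'⟩ := Finsupp.exists_eq_add_single_of_degree_eq_succ hm
    rw [apolarAction_monomial_add_single]
    rcases d with _ | d
    · rw [totalDegree_eq_zero_iff_eq_C.1 ((totalDegree_zero_iff_isHomogeneous _).2 hf), pderiv_C,
        map_zero]
    · exact ih (by omega) hm' hf.pderiv

theorem mem_apolarIdeal_of_lt {d j : ℕ} (h : d < j) {f Φ : MvPolynomial (Fin (n + 1)) K}
    (hf : f.IsHomogeneous d) (hΦ : Φ.IsHomogeneous j) : Φ ∈ apolarIdeal f := by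
  change apolarAction K n Φ f = 0
  rw [apolarAction_eq_sum]
  refine Finset.sum_eq_zero fun m hm => ?_
  rw [apolarAction_monomial_eq_zero h (hΦ.degree_eq_sum_deg_support hm).symm hf, smul_zero]

/-- The constant is `∏ (m i)!`; only its nonvanishing matters, and this is where characteristic zero
enters. -/
theorem exists_constantCoeff_apolarAction_monomial [CharZero K] (m : Fin (n + 1) →₀ ℕ) :
    ∃ c : K, c ≠ 0 ∧ ∀ g, constantCoeff (apolarAction K n (monomial m 1) g) = c * coeff m g := by
  induction hk : m.degree generalizing m with
  | zero =>
    obtain rfl := (Finsupp.degree_eq_zero_iff m).1 hk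
    exact ⟨1, one_ne_zero, fun g => by
      rw [apolarAction_monomial_zero, one_mul, constantCoeff_eq]⟩
  | succ k ih =>
    obtain ⟨i, m, rfl, hm⟩ := Finsupp.exists_eq_add_single_of_degree_eq_succ hk
    obtain ⟨c, hc, h⟩ := ih m hm
    refine ⟨c * (m i + 1), mul_ne_zero hc (Nat.cast_add_one_ne_zero _), fun g => ?_⟩
    rw [apolarAction_monomial_add_single, h, coeff_pderiv]
    ring

/-- The pairing of forms of degree `k` is diagonal in the monomial bases with nonzero entries, so
testing against one monomial isolates one coefficient of `Φ`. -/
theorem eq_zero_of_constantCoeff_apolarAction [CharZero K] {k : ℕ}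
    {Φ : MvPolynomial (Fin (n + 1)) K} (hΦ : Φ.IsHomogeneous k)
    (h : ∀ g : MvPolynomial (Fin (n + 1)) K, g.IsHomogeneous k →
      constantCoeff (apolarAction K n Φ g) = 0) : Φ = 0 := by
  ext a
  by_cases ha : a.degree = k
  · have h1 := h (monomial a 1) (isHomogeneous_monomial 1 ha)
    obtain ⟨c, hc, hca⟩ := exists_constantCoeff_apolarAction_monomial (K := K) a
    rw [apolarAction_eq_sum, map_sum, Finset.sum_eq_single a] at h1
    · rw [constantCoeff_smul, hca, coeff_monomial, if_pos rfl, smul_eq_mul, mul_one] at h1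
      exact (mul_eq_zero.1 h1).resolve_right hc
    · intro b _ hb
      obtain ⟨c, -, hcb⟩ := exists_constantCoeff_apolarAction_monomial (K := K) b
      rw [constantCoeff_smul, hcb, coeff_monomial, if_neg hb.symm, mul_zero, smul_zero]
    · intro ha
      rw [notMem_support_iff.1 ha, zero_smul, map_zero]
  · rw [hΦ.coeff_eq_zero ha, coeff_zero]

/-- Differentiating a product of `k` linear forms vanishing at `p` and a cofactor `k` times, and
evaluating at `p`, all derivatives have to hit the linear forms. -/
theorem eval_apolarAction_monomial_prod_mul {ι : Type*} (ℓ : ι → MvPolynomial (Fin (n + 1)) K)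
    (p : Fin (n + 1) → K) {k : ℕ} {m : Fin (n + 1) →₀ ℕ} (hm : m.degree = k) {T : Finset ι}
    (hT : T.card = k) (hℓ : ∀ i ∈ T, (ℓ i).IsHomogeneous 1) (hp : ∀ i ∈ T, eval p (ℓ i) = 0)
    (g : MvPolynomial (Fin (n + 1)) K) :
    eval p (apolarAction K n (monomial m 1) ((∏ i ∈ T, ℓ i) * g)) =
      constantCoeff (apolarAction K n (monomial m 1) (∏ i ∈ T, ℓ i)) * eval p g := by
  classical
  induction k generalizing m T g with
  | zero =>
    obtain rfl := Finset.card_eq_zero.1 hT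
    obtain rfl := (Finsupp.degree_eq_zero_iff m).1 hm
    simp
  | succ k ih =>
    obtain ⟨j, m, rfl, hm'⟩ := Finsupp.exists_eq_add_single_of_degree_eq_succ hm
    have hc (i) (hi : i ∈ T) : pderiv j (ℓ i) = C (coeff 0 (pderiv j (ℓ i))) :=
      totalDegree_eq_zero_iff_eq_C.1 ((totalDegree_zero_iff_isHomogeneous _).2 (hℓ i hi).pderiv)
    have key (i) (hi : i ∈ T) (g) := ih hm' (T := T.erase i)
      (by rw [Finset.card_erase_of_mem hi, hT, Nat.add_sub_cancel])
      (fun a ha => hℓ a (Finset.mem_of_mem_erase ha))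
      (fun a ha => hp a (Finset.mem_of_mem_erase ha)) g
    obtain ⟨i₀, hi₀⟩ : T.Nonempty := Finset.card_pos.1 (by omega)
    -- If a derivative is spent on the cofactor, only `k` remain for `k + 1` vanishing factors: one
    -- factor is absorbed into the cofactor, which then vanishes at `p`.
    have hlast : eval p (apolarAction K n (monomial m 1) ((∏ i ∈ T, ℓ i) * pderiv j g)) = 0 := by
      rw [← Finset.mul_prod_erase T ℓ hi₀, mul_comm (ℓ i₀), mul_assoc, key i₀ hi₀, map_mul,
        hp i₀ hi₀, zero_mul, mul_zero]
    have hprod : pderiv j (∏ i ∈ T, ℓ i) =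
        ∑ i ∈ T, coeff 0 (pderiv j (ℓ i)) • ∏ a ∈ T.erase i, ℓ a := by
      rw [Derivation.map_finsetProd]
      refine Finset.sum_congr rfl fun i hi => ?_
      rw [hc i hi, C_mul', coeff_C, if_pos rfl]
    rw [apolarAction_monomial_add_single, apolarAction_monomial_add_single, pderiv_mul, map_add,
      map_add, hlast, add_zero, hprod, Finset.sum_mul, map_sum, map_sum, map_sum, map_sum,
      Finset.sum_mul]
    refine Finset.sum_congr rfl fun i hi => ?_
    rw [smul_mul_assoc, LinearMap.map_smul, LinearMap.map_smul, smul_eval, constantCoeff_smul, key i hi, smul_eq_mul,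
      mul_assoc]

theorem eval_apolarAction_prod_mul {ι : Type*} (ℓ : ι → MvPolynomial (Fin (n + 1)) K)
    (p : Fin (n + 1) → K) {k : ℕ} {Φ : MvPolynomial (Fin (n + 1)) K} (hΦ : Φ.IsHomogeneous k)
    {T : Finset ι} (hT : T.card = k) (hℓ : ∀ i ∈ T, (ℓ i).IsHomogeneous 1)
    (hp : ∀ i ∈ T, eval p (ℓ i) = 0) (g : MvPolynomial (Fin (n + 1)) K) :
    eval p (apolarAction K n Φ ((∏ i ∈ T, ℓ i) * g)) =
      constantCoeff (apolarAction K n Φ (∏ i ∈ T, ℓ i)) * eval p g := by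
  rw [apolarAction_eq_sum, apolarAction_eq_sum, map_sum, map_sum, Finset.sum_mul]
  refine Finset.sum_congr rfl fun m hm => ?_
  rw [smul_eval, constantCoeff_smul, smul_eq_mul, mul_assoc,
    eval_apolarAction_monomial_prod_mul ℓ p (hΦ.degree_eq_sum_deg_support hm).symm hT hℓ hp]

end apolarity

/-! ### Spanning by products of linear forms in general position. -/

section linearForms

variable {K : Type*} [Field K] {n : ℕ}

theorem exists_dual_of_isHomogeneous_one {g : MvPolynomial (Fin (n + 1)) K}
    (hg : g.IsHomogeneous 1) : ∃ φ : Module.Dual K (Fin (n + 1) → K), ∀ x, φ x = eval x g := by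
  have h : g ∈ Submodule.span K (Set.range X) := by
    rw [← homogeneousSubmodule_one_eq_span_X]
    exact hg
  induction h using Submodule.span_induction with
  | mem x hx => obtain ⟨i, rfl⟩ := hx; exact ⟨LinearMap.proj i, by simp⟩
  | zero => exact ⟨0, by simp⟩
  | add x y hx hy ihx ihy =>
    rw [← homogeneousSubmodule_one_eq_span_X] at hx hy
    obtain ⟨φ, hφ⟩ := ihx hx
    obtain ⟨ψ, hψ⟩ := ihy hy
    exact ⟨φ + ψ, by simp [hφ, hψ]⟩
  | smul a x hx ih =>
    rw [← homogeneousSubmodule_one_eq_span_X] at hx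
    obtain ⟨φ, hφ⟩ := ih hx
    exact ⟨a • φ, by simp [hφ]⟩

/-- Functionals whose kernels meet only in `0` span the dual space. An infinite field allows the
resulting identity of functions to be read as one of polynomials. -/
theorem X_mem_span_of_forall_eval_eq_zero [Infinite K] {ι : Type*}
    {ℓ : ι → MvPolynomial (Fin (n + 1)) K} {U : Finset ι} (hℓ : ∀ i ∈ U, (ℓ i).IsHomogeneous 1)
    (hU : ∀ x, (∀ i ∈ U, eval x (ℓ i) = 0) → x = 0) (j : Fin (n + 1)) :
    X j ∈ Submodule.span K (ℓ '' U) := by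
  choose φ hφ using fun i : U => exists_dual_of_isHomogeneous_one (hℓ i i.2)
  have h : (LinearMap.proj j : Module.Dual K (Fin (n + 1) → K)) ∈
      Submodule.span K (Set.range φ) := by
    refine mem_span_of_iInf_ker_le_ker fun x hx => ?_
    have : x = 0 := hU x fun i hi => by
      rw [← hφ ⟨i, hi⟩]
      exact (Submodule.mem_iInf _).1 hx ⟨i, hi⟩
    simp [this]
  obtain ⟨c, hc⟩ := (Submodule.mem_span_range_iff_exists_fun K).1 h
  have hX : X j = ∑ i : U, c i • ℓ i := by
    refine MvPolynomial.funext fun x => ?_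
    have := LinearMap.congr_fun hc x
    simp only [LinearMap.sum_apply, LinearMap.smul_apply, hφ, LinearMap.proj_apply] at this
    simp [← this]
  rw [hX]
  exact Submodule.sum_mem _ fun i _ => Submodule.smul_mem _ _ (Submodule.subset_span ⟨i, i.2, rfl⟩)

/-- Products of `k` out of at least `n + k` linear forms in general position span the forms of
degree `k`. -/
theorem homogeneousSubmodule_le_span_prod {ι : Type*} {ℓ : ι → MvPolynomial (Fin (n + 1)) K}
    {B : Finset ι}
    (hB : ∀ U ⊆ B, U.card = n + 1 → ∀ j, X j ∈ Submodule.span K (ℓ '' (U : Set ι))) {k : ℕ}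
    (hk : n + k ≤ B.card) :
    homogeneousSubmodule (Fin (n + 1)) K k ≤
      Submodule.span K ((fun T => ∏ i ∈ T, ℓ i) '' (B.powersetCard k : Set (Finset ι))) := by
  classical
  suffices ∀ m : Fin (n + 1) →₀ ℕ, m.degree = k → monomial m (1 : K) ∈
      Submodule.span K ((fun T => ∏ i ∈ T, ℓ i) '' (B.powersetCard k : Set (Finset ι))) by
    intro g hg
    rw [g.as_sum]
    refine Submodule.sum_mem _ fun m hm => ?_
    rw [← mul_one (coeff m g), ← smul_eq_mul, ← smul_monomial]
    exact Submodule.smul_mem _ _ (this m (IsHomogeneous.degree_eq_sum_deg_support hg hm).symm)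
  induction k with
  | zero =>
    intro m hm
    obtain rfl := (Finsupp.degree_eq_zero_iff m).1 hm
    exact Submodule.subset_span ⟨∅, by simp, by simp⟩
  | succ k ih =>
    intro m hm
    obtain ⟨j, m, rfl, hm'⟩ := Finsupp.exists_eq_add_single_of_degree_eq_succ hm
    have h1 : monomial (m + Finsupp.single j 1) (1 : K) = LinearMap.mulLeft K (X j) (monomial m 1) := by
      rw [LinearMap.mulLeft_apply, X, monomial_mul, one_mul, add_comm m]
    rw [h1]
    rw [← Submodule.mem_comap]
    refine Submodule.span_le.2 ?_ (ih (by omega) m hm')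
    rintro _ ⟨T, hT, rfl⟩
    obtain ⟨hTB, hTk⟩ := Finset.mem_powersetCard.1 hT
    -- At least `n + 1` forms of `B` are unused by `T`. They span the variables, so multiplying by
    -- `X j` amounts to combining products with one new, distinct factor.
    obtain ⟨U, hU, hUn⟩ := Finset.exists_subset_card_eq (s := B \ T) (n := n + 1)
      (by rw [Finset.card_sdiff_of_subset hTB]; omega)
    have hX := hB U (hU.trans Finset.sdiff_subset) hUn j
    rw [SetLike.mem_coe, Submodule.mem_comap, LinearMap.mulLeft_apply, mul_comm,
      ← LinearMap.mulLeft_apply (R := K), ← Submodule.mem_comap]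
    refine Submodule.span_le.2 ?_ hX
    rintro _ ⟨i, hi, rfl⟩
    obtain ⟨hiB, hiT⟩ := Finset.mem_sdiff.1 (hU hi)
    refine Submodule.subset_span ⟨insert i T, ?_, ?_⟩
    · rw [Finset.mem_coe, Finset.mem_powersetCard, Finset.card_insert_of_notMem hiT, hTk]
      exact ⟨Finset.insert_subset hiB hTB, rfl⟩
    · simp [Finset.prod_insert hiT, mul_comm]

end linearForms

/-! ### Generic arrangements: points on prescribed hyperplanes and low-degree apolar forms. -/

namespace HyperplaneArrangement

variable {K : Type*} [Field K] {n : ℕ} {A : HyperplaneArrangement K n}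

theorem IsGeneric.iInf_eq_bot (hA : A.IsGeneric) {U : Finset (Submodule K (Fin (n + 1) → K))}
    (hU : U ⊆ A.hyperplanes) (hcard : U.card = n + 1) : ⨅ H ∈ U, H = ⊥ := by
  have h := hA U hU
  have h2 := Submodule.finrank_quotient_add_finrank (⨅ H ∈ U, H)
  rw [h, hcard, min_self, Module.finrank_fin_fun] at h2
  exact Submodule.finrank_eq_zero.1 (by omega)

/-- Since `T.card ≤ n`, adding a further hyperplane raises the codimension, so it cuts the
intersection of `T` in a proper subspace. Finitely many proper subspaces do not cover a space over
an infinite field. -/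
theorem IsGeneric.exists_mem_iff [Infinite K] (hA : A.IsGeneric)
    {T : Finset (Submodule K (Fin (n + 1) → K))} (hT : T ⊆ A.hyperplanes) (hcard : T.card ≤ n) :
    ∃ p, ∀ H ∈ A.hyperplanes, p ∈ H ↔ H ∈ T := by
  classical
  have hW : ∀ H : {H // H ∈ A.hyperplanes \ T},
      Submodule.comap (⨅ H ∈ T, H).subtype H.1 ≠ ⊤ := by
    rintro ⟨H, hH⟩ h
    obtain ⟨hHA, hHT⟩ := Finset.mem_sdiff.1 hH
    have hle : ⨅ H ∈ T, H ≤ H := Submodule.comap_subtype_eq_top.1 h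
    have h1 := hA T hT
    have h2 := hA (insert H T) (Finset.insert_subset hHA hT)
    rw [Finset.iInf_insert, inf_eq_right.2 hle, h1, Finset.card_insert_of_notMem hHT] at h2
    omega
  obtain ⟨p, hp⟩ := Submodule.exists_forall_notMem_of_forall_ne_top _ hW
  refine ⟨p, fun H hH => ⟨fun hpH => ?_, fun hHT => ?_⟩⟩
  · by_contra hHT
    exact hp ⟨H, Finset.mem_sdiff.2 ⟨hH, hHT⟩⟩ hpH
  · have := p.2
    simp only [Submodule.mem_iInf] at this
    exact this H hHT

theorem IsDefiningPolynomial.isHomogeneous {f : MvPolynomial (Fin (n + 1)) K}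
    (hf : A.IsDefiningPolynomial f) : f.IsHomogeneous A.hyperplanes.card := by
  obtain ⟨α, hα, rfl⟩ := hf
  simpa using IsHomogeneous.prod A.hyperplanes α (fun _ => 1) fun H hH => (hα H hH).1

theorem IsDefiningPolynomial.ne_zero {f : MvPolynomial (Fin (n + 1)) K}
    (hf : A.IsDefiningPolynomial f) : f ≠ 0 := by
  obtain ⟨α, hα, rfl⟩ := hf
  refine Finset.prod_ne_zero_iff.2 fun H hH h0 => ?_
  have htop : H = ⊤ := by
    refine eq_top_iff.2 fun x _ => ((hα H hH).2 x).1 ?_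
    rw [h0, map_zero]
  have h := A.codim_eq_one H hH
  rw [htop, Module.finrank_zero_of_subsingleton] at h
  exact zero_ne_one h

/-- The apolar ideal of a generic arrangement of `d` hyperplanes contains no nonzero form of
degree at most `min n (d - n)`. -/
theorem IsGeneric.eq_zero_of_mem_apolarIdeal [CharZero K] (hA : A.IsGeneric)
    {f : MvPolynomial (Fin (n + 1)) K} (hf : A.IsDefiningPolynomial f) {k : ℕ} (hkn : k ≤ n)
    (hkd : n + k ≤ A.hyperplanes.card) {Φ : MvPolynomial (Fin (n + 1)) K}
    (hΦ : Φ.IsHomogeneous k) (hΦf : Φ ∈ apolarIdeal f) : Φ = 0 := by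
  classical
  obtain ⟨α, hα, rfl⟩ := hf
  have hΦ0 : apolarAction K n Φ (∏ H ∈ A.hyperplanes, α H) = 0 := hΦf
  have hprod : ∀ T ∈ A.hyperplanes.powersetCard k,
      constantCoeff (apolarAction K n Φ (∏ H ∈ T, α H)) = 0 := by
    intro T hT
    obtain ⟨hTA, hTk⟩ := Finset.mem_powersetCard.1 hT
    obtain ⟨p, hp⟩ := hA.exists_mem_iff hTA (hTk.trans_le hkn)
    have h := eval_apolarAction_prod_mul α p hΦ hTk (fun H hH => (hα H (hTA hH)).1)
      (fun H hH => ((hα H (hTA hH)).2 p).2 ((hp H (hTA hH)).2 hH))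
      (∏ H ∈ A.hyperplanes \ T, α H)
    rw [mul_comm (∏ H ∈ T, α H), Finset.prod_sdiff hTA, hΦ0, map_zero, eq_comm, mul_eq_zero, map_prod (eval p)] at h
    refine h.resolve_right (Finset.prod_ne_zero_iff.2 fun H hH h0 => ?_)
    obtain ⟨hHA, hHT⟩ := Finset.mem_sdiff.1 hH
    exact hHT ((hp H hHA).1 (((hα H hHA).2 p).1 h0))
  have hspan := homogeneousSubmodule_le_span_prod (ℓ := α) (B := A.hyperplanes)
    (fun U hU hUn j => X_mem_span_of_forall_eval_eq_zero (fun H hH => (hα H (hU hH)).1)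
      (fun x hx => by
        rw [← Submodule.mem_bot K, ← hA.iInf_eq_bot hU hUn]
        simp only [Submodule.mem_iInf]
        exact fun H hH => ((hα H (hU hH)).2 x).1 (hx H hH)) j) hkd
  refine eq_zero_of_constantCoeff_apolarAction hΦ fun g hg => ?_
  have hg' := hspan hg
  clear hg
  induction hg' using Submodule.span_induction with
  | mem x hx => obtain ⟨T, hT, rfl⟩ := hx; exact hprod T hT
  | zero => simp
  | add x y _ _ hx hy => rw [map_add, map_add, hx, hy, add_zero]
  | smul a x _ hx => rw [LinearMap.map_smul, constantCoeff_smul, hx, smul_zero]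

end HyperplaneArrangement

/-! ### The lower bound on the number of hyperplanes. -/

theorem corollary4p6 {K : Type*} [Field K] [IsAlgClosed K] [CharZero K] (n : ℕ)
    (A : HyperplaneArrangement K n) (hA : A.IsGeneric) (hcard : n + 2 ≤ A.hyperplanes.card)
    (f : MvPolynomial (Fin (n + 1)) K) (hf : A.IsDefiningPolynomial f)
    (hci : IsGradedCompleteIntersection (apolarIdeal f)) :
    n * (n + 1) ≤ A.hyperplanes.card := by
  obtain ⟨rs, hrs, hreg, hI⟩ := hci
  set d := A.hyperplanes.card with hd
  set m := min n (d - n) with hm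
  have hproper : (1 : MvPolynomial (Fin (n + 1)) K) ∉ apolarIdeal f := fun h => hf.ne_zero <| by
    have h1 : apolarAction K n 1 f = 0 := h
    rwa [map_one, Module.End.one_apply] at h1
  have hdeg : ∀ r ∈ rs, m + 1 ≤ r.totalDegree := by
    intro r hr
    obtain ⟨e, he⟩ := hrs r hr
    have hr0 : r ≠ 0 := by
      -- A zero entry, being regular modulo its predecessors, would put `1` in the ideal they
      -- generate.
      rintro rfl
      obtain ⟨i, hi, hi0⟩ := List.mem_iff_getElem.1 hr
      have h := (isSMulRegular_quotient_iff_mem_of_smul_mem _ _).1 (hreg.regular_mod_prev i hi) 1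
        (by rw [hi0, zero_smul]; exact zero_mem _)
      rw [smul_eq_mul, Ideal.mul_top] at h
      exact hproper (hI ▸ Ideal.span_mono (fun x hx => List.mem_of_mem_take hx) h)
    by_contra! hlt
    rw [he.totalDegree hr0] at hlt
    refine hr0 (hA.eq_zero_of_mem_apolarIdeal hf (k := e) (by omega) (by omega) he ?_)
    rw [hI]
    exact Ideal.subset_span hr
  obtain ⟨hlen, hsum⟩ := length_and_sum_totalDegree_le hrs (fun r hr => (hdeg r hr).trans' (by omega))
    hreg.toIsWeaklyRegular (d := d) fun j hj p hp => hI ▸ mem_apolarIdeal_of_lt hj hf.isHomogeneous hp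
  have hle : rs.length * (m + 1) ≤ (rs.map totalDegree).sum := by
    have := List.card_nsmul_le_sum (rs.map totalDegree) (m + 1) (by simpa using hdeg)
    simpa using this
  have hmul : (n + 1) * (m + 1) ≤ rs.length * (m + 1) := Nat.mul_le_mul_right _ hlen
  have hmain : (n + 1) * m ≤ d := by
    have : (n + 1) * (m + 1) = (n + 1) * m + (n + 1) := by ring
    omega
  rcases le_total n (d - n) with h | h
  · rw [hm, min_eq_left h] at hmain
    linarith
  -- This case is impossible: with `c = d - n ≥ 2`, the bound `(n + 1) c ≤ n + c` gives `n c ≤ n`,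
  -- so `n = 0`, contradicting `c ≤ n`.
  · rw [hm, min_eq_right h] at hmain
    obtain ⟨c, hc⟩ := Nat.exists_eq_add_of_le (show n ≤ d by omega)
    rw [hc, Nat.add_sub_cancel_left] at h hmain
    nlinarith
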